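/- Let $t>0$, $T=\sqrt t$, and let $\theta_0,p,\zeta,r\in\mathbb R$ with $r>-1$; if $r<0$, assume moreover $\zeta\notin\mathbb Z$. Consider in $L_2(S^1,\tfrac{d\phi}{2\pi})$ the (non-normalised) $U(1)$ coherent state $$\Psi(\phi)=\Psi^t_{\theta_0,p}(\phi;\zeta)=\sum_{n\in\mathbb Z}e^{-\frac t2(n+\zeta)^2}e^{i(n+\zeta)(\phi-(\theta_0+ip))},$$ and let $\hat p=-it\,\frac{d}{d\phi}$ be the self-adjoint momentum operator with the quasiperiodic boundary condition $u(2\pi)=e^{2\pi i\zeta}u(0)$; $|\hat p|^r$ is defined by the spectral calculus (with $0^0=1$). Let ${}_1F_1(a,b,z)=\sum_{n\ge0}\frac{(a)_n}{(b)_n\,n!}z^n$ be Kummer's function, where $(a)_n=a(a+1)\cdots(a+n-1)$. Then $\Psi\neq0$, $\Psi$ lies in the domain of $|\hat p|^r$, the expectation value of $|\hat p|^r$ is $$\frac{\langle\Psi,|\hat p|^r\Psi\rangle}{\|\Psi\|^2}=\|\Psi\|^{-2}\,T^{r-1}\,\Gamma\!\left(\tfrac{r+1}{2}\right)\sum_{N=-\infty}^{\infty}e^{2\pi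 iN\zeta}\,{}_1F_1\!\left(\tfrac{r+1}{2},\tfrac12,\Big(\tfrac{p-\pi iN}{T}\Big)^{2}\right),$$ where the two-sided series converges in the sense that its partial sums $\sum_{N=-M}^{K}$ converge as $M,K\to\infty$ independently, and the squared norm is $$\|\Psi\|^2=\sum_{n\in\mathbb Z}e^{-t(n+\zeta)^2}e^{2(n+\zeta)p}=\sqrt{\frac{\pi}{t}}\sum_{N\in\mathbb Z}e^{2\pi iN\zeta}e^{-(ip+N\pi)^2/t},$$ both series being absolutely convergent. -/

import Mathlib

open scoped ENNReal

noncomputable section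

namespace CircleCoherent

/-- The normalised Lebesgue measure `dφ / 2π` on the fundamental domain `(0, 2π]` of the circle. -/
def circleMeasure : MeasureTheory.Measure ℝ :=
  ENNReal.ofReal ((2 * Real.pi)⁻¹) • MeasureTheory.volume.restrict (Set.Ioc 0 (2 * Real.pi))

instance : MeasureTheory.IsFiniteMeasure circleMeasure := by
  unfold circleMeasure
  exact MeasureTheory.Measure.smul_finite _ ENNReal.ofReal_ne_top

/-- The Hilbert space `L₂(S¹, dφ / 2π)`; a quasiperiodic function is represented by its
restriction to the fundamental domain. -/
abbrev CircleL2 : Type := MeasureTheory.Lp ℂ 2 circleMeasure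

/-- The Kummer confluent hypergeometric function of the first kind,
`₁F₁(a, b, z) = ∑ₙ (a)ₙ / ((b)ₙ n!) zⁿ`, with `(a)ₙ` the rising factorial. -/
def kummer (a b z : ℂ) : ℂ :=
  ∑' n : ℕ, (ascPochhammer ℂ n).eval a / ((ascPochhammer ℂ n).eval b * (n.factorial : ℂ)) * z ^ n

/-- Convergence of a two-sided series `∑_{N = -∞}^{∞} f N` to `S`: the partial sums
`∑_{N = -M}^{K} f N` tend to `S` as `M` and `K` tend to infinity independently. -/
def HasBilateralSum (f : ℤ → ℂ) (S : ℂ) : Prop :=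
  Filter.Tendsto (fun q : ℕ × ℕ => ∑ N ∈ Finset.Icc (-(q.1 : ℤ)) (q.2 : ℤ), f N)
    Filter.atTop (nhds S)

/-- The `n`-th term of the coherent state,
`exp(-(t/2) (n + ζ)²) exp(i (n + ζ) (φ - (θ₀ + i p)))`. -/
def coherentTerm (t θ₀ p ζ : ℝ) (n : ℤ) (φ : ℝ) : ℂ :=
  Complex.exp (-((t : ℂ) / 2) * ((n : ℂ) + ζ) ^ 2) *
    Complex.exp (Complex.I * ((n : ℂ) + ζ) * ((φ : ℂ) - ((θ₀ : ℂ) + Complex.I * p)))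

/-- The non-normalised `U(1)` coherent state as a function of the angle `φ`. -/
def coherentFun (t θ₀ p ζ : ℝ) (φ : ℝ) : ℂ :=
  ∑' n : ℤ, coherentTerm t θ₀ p ζ n φ

lemma norm_coherentTerm (t θ₀ p ζ : ℝ) (n : ℤ) (φ : ℝ) :
    ‖coherentTerm t θ₀ p ζ n φ‖ =
      Real.exp (-(t / 2) * ((n : ℝ) + ζ) ^ 2 + ((n : ℝ) + ζ) * p) := by
  have h : coherentTerm t θ₀ p ζ n φ =
      Complex.exp (((-(t / 2) * ((n : ℝ) + ζ) ^ 2 + ((n : ℝ) + ζ) * p : ℝ) : ℂ) +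
        (((n : ℝ) + ζ) * (φ - θ₀) : ℝ) * Complex.I) := by
    unfold coherentTerm
    rw [← Complex.exp_add]
    congr 1
    push_cast
    linear_combination (-((n : ℂ) + ζ) * p) * Complex.I_sq
  rw [h, Complex.exp_add, norm_mul, Complex.norm_exp_ofReal_mul_I, mul_one, Complex.norm_exp,
    Complex.ofReal_re]

lemma summable_coherentBound {t : ℝ} (ht : 0 < t) (p ζ : ℝ) :
    Summable (fun n : ℤ => Real.exp (-(t / 2) * ((n : ℝ) + ζ) ^ 2 + ((n : ℝ) + ζ) * p)) := by
  have hτ : 0 < (((t / (2 * Real.pi) : ℝ) : ℂ) * Complex.I).im := by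
    simp only [Complex.mul_im, Complex.ofReal_re, Complex.I_im, Complex.ofReal_im, Complex.I_re]
    have := Real.pi_pos
    simp only [mul_one, mul_zero, add_zero]
    positivity
  have h := ((summable_jacobiTheta₂_term_iff
    (((t * ζ - p) / (2 * Real.pi) : ℝ) * Complex.I) _).2 hτ).norm
  refine (h.mul_left (Real.exp (-(t / 2) * ζ ^ 2 + ζ * p))).congr fun n => ?_
  rw [norm_jacobiTheta₂_term, ← Real.exp_add]
  congr 1
  simp only [Complex.mul_im, Complex.ofReal_re, Complex.I_im, Complex.ofReal_im, Complex.I_re]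
  field_simp
  ring

lemma continuous_coherentFun {t : ℝ} (ht : 0 < t) (θ₀ p ζ : ℝ) :
    Continuous (coherentFun t θ₀ p ζ) := by
  refine continuous_tsum (fun n => ?_) (summable_coherentBound ht p ζ)
    (fun n φ => (norm_coherentTerm t θ₀ p ζ n φ).le)
  unfold coherentTerm
  fun_prop

lemma memLp_coherentFun {t : ℝ} (ht : 0 < t) (θ₀ p ζ : ℝ) :
    MeasureTheory.MemLp (coherentFun t θ₀ p ζ) 2 circleMeasure := by
  refine MeasureTheory.MemLp.of_bound
    (continuous_coherentFun ht θ₀ p ζ).aestronglyMeasurable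
    (∑' n : ℤ, Real.exp (-(t / 2) * ((n : ℝ) + ζ) ^ 2 + ((n : ℝ) + ζ) * p))
    (Filter.Eventually.of_forall fun φ => ?_)
  exact tsum_of_norm_bounded (summable_coherentBound ht p ζ).hasSum
    (fun n => (norm_coherentTerm t θ₀ p ζ n φ).le)

/-- The coherent state as a vector of `L₂(S¹)`. -/
def coherentState {t : ℝ} (ht : 0 < t) (θ₀ p ζ : ℝ) : CircleL2 :=
  (memLp_coherentFun ht θ₀ p ζ).toLp (coherentFun t θ₀ p ζ)

lemma ae_restrict_of_ae {P : ℝ → Prop} (h : ∀ᵐ x ∂circleMeasure, P x) :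
    ∀ᵐ x ∂MeasureTheory.volume.restrict (Set.Ioc 0 (2 * Real.pi)), P x := by
  refine (MeasureTheory.Measure.AbsolutelyContinuous.ae_le ?_) h
  refine MeasureTheory.Measure.absolutelyContinuous_smul ?_
  have := Real.pi_pos
  simp only [ne_eq, ENNReal.ofReal_eq_zero, not_le]
  positivity

lemma intervalIntegrable_coe (χ : CircleL2) {φ : ℝ} (hφ : φ ∈ Set.Icc 0 (2 * Real.pi)) :
    IntervalIntegrable (fun s => (χ : ℝ → ℂ) s) MeasureTheory.volume 0 φ := by
  have h1 : MeasureTheory.Integrable (χ : ℝ → ℂ) circleMeasure :=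
    (MeasureTheory.Lp.memLp χ).integrable (by norm_num)
  have h2 : MeasureTheory.IntegrableOn (χ : ℝ → ℂ) (Set.Ioc 0 (2 * Real.pi)) := by
    have hc : ENNReal.ofReal ((2 * Real.pi)⁻¹) ≠ 0 := by
      have := Real.pi_pos
      simp only [ne_eq, ENNReal.ofReal_eq_zero, not_le]
      positivity
    exact (MeasureTheory.integrable_smul_measure hc ENNReal.ofReal_ne_top).1 h1
  rw [intervalIntegrable_iff_integrableOn_Ioc_of_le hφ.1]
  exact h2.mono_set (Set.Ioc_subset_Ioc_right hφ.2)

lemma integral_congr_circle {f g : ℝ → ℂ} (h : f =ᵐ[circleMeasure] g) {φ : ℝ}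
    (hφ : φ ∈ Set.Icc 0 (2 * Real.pi)) : ∫ s in (0 : ℝ)..φ, f s = ∫ s in (0 : ℝ)..φ, g s := by
  rw [intervalIntegral.integral_of_le hφ.1, intervalIntegral.integral_of_le hφ.1]
  refine MeasureTheory.integral_congr_ae ?_
  exact MeasureTheory.ae_restrict_of_ae_restrict_of_subset (Set.Ioc_subset_Ioc_right hφ.2)
    (ae_restrict_of_ae h)

/-- The graph of the momentum operator `p̂ = -i t d/dφ` on `L₂(S¹)` with the quasiperiodic boundary
condition `u(2π) = exp(2πiζ) u(0)` satisfied by the coherent states with parameter `ζ`. A pair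
`(ψ, χ)` belongs to it when `ψ` has an absolutely continuous representative `u` that satisfies the
boundary condition and has derivative `u' = (i/t) χ`, that is `χ = -i t u'`. -/
def momentum (t ζ : ℝ) : Submodule ℂ (CircleL2 × CircleL2) where
  carrier := {x | ∃ u : ℝ → ℂ, (x.1 : ℝ → ℂ) =ᵐ[circleMeasure] u ∧
    u (2 * Real.pi) = Complex.exp (2 * Real.pi * Complex.I * ζ) * u 0 ∧
    ∀ φ ∈ Set.Icc (0 : ℝ) (2 * Real.pi),
      u φ = u 0 + (Complex.I / t) * ∫ s in (0 : ℝ)..φ, (x.2 : ℝ → ℂ) s}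
  add_mem' := by
    rintro ⟨a, b⟩ ⟨c, d⟩ ⟨u, hu, hu0, hui⟩ ⟨v, hv, hv0, hvi⟩
    refine ⟨fun x => u x + v x, ?_, ?_, fun φ hφ => ?_⟩
    · exact (MeasureTheory.Lp.coeFn_add a c).trans (hu.add hv)
    · simp only [hu0, hv0]; ring
    · have h := integral_congr_circle (MeasureTheory.Lp.coeFn_add b d) hφ
      simp only [Prod.mk_add_mk] at *
      rw [h]
      simp only [Pi.add_apply]
      rw [intervalIntegral.integral_add (intervalIntegrable_coe b hφ) (intervalIntegrable_coe d hφ),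
        hui φ hφ, hvi φ hφ]
      ring
  zero_mem' := by
    refine ⟨fun _ => 0, MeasureTheory.Lp.coeFn_zero _ _ _, by simp, fun φ hφ => ?_⟩
    have h := integral_congr_circle (MeasureTheory.Lp.coeFn_zero ℂ 2 circleMeasure) hφ
    simp only [Prod.snd_zero]
    rw [h]
    simp
  smul_mem' := by
    rintro c ⟨a, b⟩ ⟨u, hu, hu0, hui⟩
    refine ⟨fun x => c * u x, ?_, ?_, fun φ hφ => ?_⟩
    · exact (MeasureTheory.Lp.coeFn_smul c a).trans (hu.const_smul c)
    · simp only [hu0]; ring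
    · have h := integral_congr_circle (MeasureTheory.Lp.coeFn_smul c b) hφ
      simp only [Prod.smul_mk] at *
      rw [h]
      simp only [Pi.smul_apply, smul_eq_mul]
      rw [intervalIntegral.integral_const_mul, hui φ hφ]
      ring

section Spectral

variable {H : Type*} [NormedAddCommGroup H] [InnerProductSpace ℂ H] [CompleteSpace H]

/-- The eigenspace `{ψ | A ψ = μ ψ}` of an operator given by its graph `A`. -/
def eigenspace (A : Submodule ℂ (H × H)) (μ : ℝ) : Submodule ℂ H :=
  A.comap (LinearMap.prod LinearMap.id ((μ : ℂ) • LinearMap.id))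

/-- The spectral projection of `A` at the real number `μ`: the orthogonal projection onto the
(closed) eigenspace for `μ`. -/
def spectralProj (A : Submodule ℂ (H × H)) (μ : ℝ) : H →L[ℂ] H :=
  (eigenspace A μ).topologicalClosure.starProjection

/-- The function `f(A) = ∑_μ f(μ) P_μ` of a self-adjoint operator `A` with pure point spectrum,
where `μ` runs over the real numbers and `P_μ` is the orthogonal projection onto the eigenspace for
`μ` (zero unless `μ` is an eigenvalue). Its domain consists of all vectors for which the orthogonal
series converges. -/
def spectralFun (A : Submodule ℂ (H × H)) (f : ℝ → ℝ) : H →ₗ.[ℂ] H where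
  domain :=
    { carrier := {ψ | Summable fun μ : ℝ => (f μ : ℂ) • spectralProj A μ ψ}
      add_mem' := by
        intro a b ha hb
        simp only [Set.mem_ofPred_eq, map_add, smul_add] at *
        exact ha.add hb
      zero_mem' := by
        simp only [Set.mem_ofPred_eq, map_zero, smul_zero]
        exact summable_zero
      smul_mem' := by
        intro c a ha
        simp only [Set.mem_ofPred_eq, map_smul] at *
        simpa only [smul_comm c] using ha.const_smul c }
  toFun :=
    { toFun := fun ψ => ∑' μ : ℝ, (f μ : ℂ) • spectralProj A μ (ψ : H)
      map_add' := by
        rintro ⟨a, ha⟩ ⟨b, hb⟩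
        simp only [AddMemClass.mk_add_mk, map_add, smul_add]
        exact Summable.tsum_add ha hb
      map_smul' := by
        rintro c ⟨a, ha⟩
        simp only [SetLike.mk_smul_mk, map_smul, RingHom.id_apply, smul_comm _ c]
        exact Summable.tsum_const_smul c ha }

/-- The expectation value `‖ψ‖⁻² ⟨ψ | A ψ⟩` of an operator in a not necessarily normalised vector
of its domain. -/
def expectation (A : H →ₗ.[ℂ] H) (ψ : A.domain) : ℂ :=
  inner ℂ (ψ : H) (A ψ) / ((‖(ψ : H)‖ ^ 2 : ℝ) : ℂ)

end Spectral

/-- The operator `|p̂|^r` on `L₂(S¹)`. -/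
def absMomentumPow (t ζ r : ℝ) : CircleL2 →ₗ.[ℂ] CircleL2 :=
  spectralFun (momentum t ζ) (fun μ => |μ| ^ r)

end CircleCoherent

end

namespace CircleCoherent

open MeasureTheory Filter Topology Complex

/-! The plane waves `exp(i(n+ζ)φ)` are orthonormal eigenvectors of the momentum operator with
eigenvalues `t(n+ζ)`. Expanding Ψ in them (`hasSum_coherentState`) turns `⟨Ψ, |p̂|^r Ψ⟩` into `t^r ∑
h(n)`, where `h(x) = |x+ζ|^r exp(-t(x+ζ)² + 2(x+ζ)p)`, and Poisson summation does the rest.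

Since `h` may be singular at `-ζ`, its Fourier coefficients need not be summable, so an absolutely
convergent Poisson formula is not enough. `poisson_of_dini` writes `h(x) - h(round x) = (exp(-2πix)
- 1) g(x)`. If `g` is integrable, then `ĥ(N)` is the coefficient of the step function `h ∘ round`,
which is `∑ h(n)` at `N = 0` and zero elsewhere, plus `ĝ(N+1) - ĝ(N)`. The differences telescope,
and Riemann–Lebesgue removes both ends independently. Integrability of `g` is
`integrable_dini_momentDensity`.

Each `ĥ(N)` is a Gaussian moment with complex linear term `p - πiN`; integrating the cosh series
termwise produces Kummer's function (`integral_abs_rpow_mul_exp`). The norm identity is the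
classical theta inversion. -/

/-! ### Two-sided series and Poisson summation under a Dini condition. -/

lemma sum_Icc_int_telescope (G : ℤ → ℂ) (a : ℤ) (L : ℕ) :
    ∑ N ∈ Finset.Icc a (a + L), (G (N + 1) - G N) = G (a + L + 1) - G a := by
  induction L with
  | zero => simp
  | succ L ih =>
    have h : Finset.Icc a (a + ((L + 1 : ℕ) : ℤ)) =
        insert (a + L + 1) (Finset.Icc a (a + (L : ℤ))) := by
      ext x
      simp only [Finset.mem_Icc, Finset.mem_insert]
      push_cast
      omega
    rw [h, Finset.sum_insert (by simp), ih]
    push_cast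
    rw [← add_assoc]
    ring

lemma HasBilateralSum.add {f g : ℤ → ℂ} {S R : ℂ} (hf : HasBilateralSum f S)
    (hg : HasBilateralSum g R) : HasBilateralSum (fun N => f N + g N) (S + R) := by
  unfold HasBilateralSum at *
  simpa only [Finset.sum_add_distrib] using hf.add hg

/-- A two-sided telescoping series whose primitive vanishes at infinity has sum zero. -/
lemma hasBilateralSum_telescope {G : ℤ → ℂ} (h1 : Tendsto G atTop (𝓝 0))
    (h2 : Tendsto G atBot (𝓝 0)) : HasBilateralSum (fun N => G (N + 1) - G N) 0 := by
  have e : (fun q : ℕ × ℕ => ∑ N ∈ Finset.Icc (-(q.1 : ℤ)) (q.2 : ℤ), (G (N + 1) - G N)) =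
      fun q : ℕ × ℕ => G ((q.2 : ℤ) + 1) - G (-(q.1 : ℤ)) := by
    funext q
    have := sum_Icc_int_telescope G (-(q.1 : ℤ)) (q.1 + q.2)
    push_cast at this
    simpa using this
  unfold HasBilateralSum
  rw [e, ← sub_zero (0 : ℂ), ← prod_atTop_atTop_eq]
  refine Tendsto.sub (h1.comp ?_) (h2.comp ?_)
  · exact tendsto_atTop_add_const_right _ _ (tendsto_natCast_atTop_atTop.comp tendsto_snd)
  · exact tendsto_neg_atTop_atBot.comp (tendsto_natCast_atTop_atTop.comp tendsto_fst)

lemma hasBilateralSum_single (S : ℂ) : HasBilateralSum (fun N => if N = 0 then S else 0) S := by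
  unfold HasBilateralSum
  refine tendsto_const_nhds.congr fun q => ?_
  rw [Finset.sum_ite_eq' (Finset.Icc (-(q.1 : ℤ)) (q.2 : ℤ)) 0 (fun _ => S)]
  simp

/-- The Fourier coefficient `∫ exp(-2πiNx) w(x) dx`. -/
noncomputable def fourierInt (w : ℝ → ℂ) (N : ℤ) : ℂ :=
  ∫ x : ℝ, cexp (-2 * Real.pi * I * N * x) * w x

lemma norm_fourierChar (N : ℤ) (x : ℝ) : ‖cexp (-2 * Real.pi * I * N * x)‖ = 1 := by
  have : (-2 * Real.pi * I * N * x : ℂ) = ((-2 * Real.pi * N * x : ℝ) : ℂ) * I := by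
    push_cast; ring
  rw [this, norm_exp_ofReal_mul_I]

lemma integrable_fourierChar_mul {w : ℝ → ℂ} (hw : Integrable w) (N : ℤ) :
    Integrable (fun x : ℝ => cexp (-2 * Real.pi * I * N * x) * w x) := by
  refine hw.bdd_mul (c := 1) (by fun_prop) (Eventually.of_forall fun x => ?_)
  exact (norm_fourierChar N x).le

/-- Riemann–Lebesgue. Integrability of `w` can be omitted because the integrals of a non-integrable
function are zero by convention. -/
lemma tendsto_fourierInt_cocompact (w : ℝ → ℂ) :
    Tendsto (fun y : ℝ => ∫ x : ℝ, cexp (-2 * Real.pi * I * y * x) * w x) (cocompact ℝ) (𝓝 0) := by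
  refine (Real.tendsto_integral_exp_smul_cocompact w).congr fun y => ?_
  refine integral_congr_ae (Eventually.of_forall fun x => ?_)
  simp only [Circle.smul_def, Real.fourierChar_apply, smul_eq_mul]
  congr 2
  push_cast
  ring

lemma tendsto_fourierInt_atTop (w : ℝ → ℂ) : Tendsto (fourierInt w) atTop (𝓝 0) := by
  have h := (tendsto_fourierInt_cocompact w).comp
    ((tendsto_intCast_atTop_atTop (R := ℝ)).mono_right (atTop_le_cocompact))
  refine h.congr fun N => ?_
  simp [fourierInt]

lemma tendsto_fourierInt_atBot (w : ℝ → ℂ) : Tendsto (fourierInt w) atBot (𝓝 0) := by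
  have h := (tendsto_fourierInt_cocompact w).comp
    ((tendsto_intCast_atBot_iff (R := ℝ).2 tendsto_id).mono_right (atBot_le_cocompact))
  refine h.congr fun N => ?_
  simp [fourierInt]

lemma intervalIntegral_round_cell (h : ℝ → ℂ) (N n : ℤ) :
    ∫ x in (-(1 / 2) + n : ℝ)..(-(1 / 2) + n + 1),
      cexp (-2 * Real.pi * I * N * x) * h (round x : ℤ) = if N = 0 then h n else 0 := by
  have e : ∫ x in (-(1 / 2) + n : ℝ)..(-(1 / 2) + n + 1),
      cexp (-2 * Real.pi * I * N * x) * h (round x : ℤ) =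
      ∫ x in (-(1 / 2) + n : ℝ)..(-(1 / 2) + n + 1), cexp (-2 * Real.pi * I * N * x) * h n := by
    -- The right endpoint rounds up to `n + 1`, so the open interval is used.
    rw [intervalIntegral.integral_of_le (by linarith), intervalIntegral.integral_of_le (by linarith),
      integral_Ioc_eq_integral_Ioo, integral_Ioc_eq_integral_Ioo]
    refine setIntegral_congr_fun measurableSet_Ioo fun x hx => ?_
    have : round x = n := round_eq_iff.2 ⟨by linarith [hx.1], by linarith [hx.2]⟩
    simp only [this]
  rw [e, intervalIntegral.integral_mul_const]
  split_ifs with hN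
  · simp [hN]
  · have hc : (-2 * Real.pi * I * N : ℂ) ≠ 0 := by
      simp [hN, Real.pi_ne_zero]
    rw [integral_exp_mul_complex hc]
    have : cexp (-2 * Real.pi * I * N * ((-(1 / 2) + n + 1 : ℝ) : ℂ)) =
        cexp (-2 * Real.pi * I * N * ((-(1 / 2) + n : ℝ) : ℂ)) := by
      rw [exp_eq_exp_iff_exists_int]
      exact ⟨-N, by push_cast; ring⟩
    rw [this]
    simp

/-- Poisson summation under a Dini condition at the integers. -/
theorem poisson_of_dini {h : ℝ → ℂ} (hh : Integrable h)
    (hg : Integrable (fun x : ℝ => (h x - h (round x : ℤ)) / (cexp (-2 * Real.pi * I * x) - 1))) :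
    ∃ S : ℂ, HasSum (fun n : ℤ => h n) S ∧ HasBilateralSum (fourierInt h) S := by
  set g : ℝ → ℂ := fun x => (h x - h (round x : ℤ)) / (cexp (-2 * Real.pi * I * x) - 1) with g_def
  have hk (x : ℝ) : h x - h (round x : ℤ) = cexp (-2 * Real.pi * I * x) * g x - g x := by
    -- At an integer the denominator of `g` vanishes, but so does `h x - h (round x)`, and the
    -- factorisation persists.
    by_cases hx : cexp (-2 * Real.pi * I * x) = 1
    · obtain ⟨n, hn⟩ := exp_eq_one_iff.1 hx
      have hxn : x = ((-n : ℤ) : ℝ) := by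
        have h2 : (2 * Real.pi * I : ℂ) ≠ 0 := two_pi_I_ne_zero
        have : (x : ℂ) = ((-n : ℤ) : ℂ) := by
          apply mul_left_cancel₀ h2
          push_cast
          linear_combination -hn
        exact_mod_cast this
      rw [hx, hxn, round_intCast]
      ring
    · have hx' : cexp (-2 * Real.pi * I * x) - 1 ≠ 0 := sub_ne_zero.2 hx
      rw [← sub_one_mul, g_def, mul_div_cancel₀ _ hx']
  have hEg : Integrable (fun x : ℝ => cexp (-2 * Real.pi * I * x) * g x) := by
    simpa using integrable_fourierChar_mul hg 1
  -- Integrability of the step function is what yields summability of `h n`; it follows from that of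
  -- `h` and `g`.
  have hs : Integrable (fun x : ℝ => h (round x : ℤ)) := by
    refine (hh.sub (hEg.sub hg)).congr (Eventually.of_forall fun x => ?_)
    simp only [Pi.sub_apply]
    rw [← hk x]
    ring
  have hcell (N : ℤ) : HasSum (fun n : ℤ => if N = 0 then h n else 0)
      (fourierInt (fun x => h (round x : ℤ)) N) := by
    have := (integrable_fourierChar_mul hs N).hasSum_intervalIntegral (-(1 / 2))
    simp only [intervalIntegral_round_cell] at this
    exact this
  have hS : HasSum (fun n : ℤ => h n) (fourierInt (fun x => h (round x : ℤ)) 0) := by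
    simpa using hcell 0
  refine ⟨_, hS, ?_⟩
  have h0 (N : ℤ) : fourierInt (fun x => h (round x : ℤ)) N =
      if N = 0 then fourierInt (fun x => h (round x : ℤ)) 0 else 0 := by
    split_ifs with hN
    · rw [hN]
    · have := hcell N
      simp only [hN, if_false] at this
      exact this.unique hasSum_zero
  -- Multiplication by `exp(-2πix)` shifts the Fourier index by one, so the remainder becomes a
  -- difference.
  have hdec (N : ℤ) : fourierInt h N =
      (if N = 0 then fourierInt (fun x => h (round x : ℤ)) 0 else 0) +
        (fourierInt g (N + 1) - fourierInt g N) := by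
    rw [← h0]
    unfold fourierInt
    rw [← integral_sub (integrable_fourierChar_mul hg _) (integrable_fourierChar_mul hg _)]
    refine Eq.trans ?_ (integral_add (integrable_fourierChar_mul hs _)
        ((integrable_fourierChar_mul hg _).sub (integrable_fourierChar_mul hg _)))
    refine integral_congr_ae (Eventually.of_forall fun x => ?_)
    have e : cexp (-2 * Real.pi * I * ((N + 1 : ℤ) : ℂ) * x) =
        cexp (-2 * Real.pi * I * N * x) * cexp (-2 * Real.pi * I * x) := by
      rw [← Complex.exp_add]
      congr 1
      push_cast
      ring
    simp only [e]
    linear_combination (cexp (-2 * Real.pi * I * N * x)) * hk x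
  have := (hasBilateralSum_single (fourierInt (fun x => h (round x : ℤ)) 0)).add
    (hasBilateralSum_telescope (tendsto_fourierInt_atTop g) (tendsto_fourierInt_atBot g))
  rw [add_zero] at this
  exact (funext hdec : fourierInt h = _) ▸ this

/-! ### Gaussian moments and Kummer's function. -/

lemma ae_ne_zero_real : ∀ᵐ x : ℝ, x ≠ 0 := by
  simp [ae_iff]

lemma integrable_comp_abs {f : ℝ → ℝ} (hf : IntegrableOn f (Set.Ioi 0)) :
    Integrable (fun x => f |x|) := by
  have h := (integrable_indicator_iff measurableSet_Ioi).2 hf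
  refine (h.add h.comp_neg).congr ?_
  filter_upwards [ae_ne_zero_real] with x hx
  rcases lt_or_gt_of_ne hx with hx | hx
  · simp [Set.indicator, hx, abs_of_neg, not_lt.2 hx.le]
  · simp [Set.indicator, hx, abs_of_pos, not_lt.2 hx.le]

lemma integrable_abs_rpow_mul_gaussian {b r : ℝ} (hb : 0 < b) (hr : -1 < r) :
    Integrable (fun x : ℝ => |x| ^ r * Real.exp (-b * x ^ 2)) := by
  simpa only [sq_abs] using integrable_comp_abs (integrableOn_rpow_mul_exp_neg_mul_sq hb hr)

lemma integral_abs_rpow_mul_gaussian {b r : ℝ} (hb : 0 < b) (hr : -1 < r) :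
    ∫ x : ℝ, |x| ^ r * Real.exp (-b * x ^ 2) =
      b ^ (-(r + 1) / 2) * Real.Gamma ((r + 1) / 2) := by
  have h1 := integral_comp_abs (f := fun x => x ^ r * Real.exp (-b * x ^ (2 : ℝ)))
  rw [integral_rpow_mul_exp_neg_mul_rpow two_pos hr hb] at h1
  simp only [Real.rpow_ofNat, sq_abs] at h1
  rw [h1]
  ring

lemma gaussian_exponent_le {t : ℝ} (ht : 0 < t) (x c : ℝ) :
    -t * x ^ 2 + 2 * x * c ≤ -(t / 2) * x ^ 2 + 2 * c ^ 2 / t := by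
  have : 0 ≤ (t * x - 2 * c) ^ 2 / (2 * t) := by positivity
  have e : (t * x - 2 * c) ^ 2 / (2 * t) = t / 2 * x ^ 2 - 2 * x * c + 2 * c ^ 2 / t := by
    field_simp
    ring
  linarith

lemma norm_gaussian_exp (t : ℝ) (w : ℂ) (x : ℝ) :
    ‖cexp (-t * x ^ 2 + 2 * x * w)‖ = Real.exp (-t * x ^ 2 + 2 * x * w.re) := by
  rw [norm_exp]
  congr 1
  have : (-t * x ^ 2 + 2 * x * w : ℂ) = ((-t * x ^ 2 : ℝ) : ℂ) + ((2 * x : ℝ) : ℂ) * w := by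
    push_cast; ring
  rw [this, add_re, ofReal_re, re_ofReal_mul]

lemma integrable_abs_rpow_mul_exp {t r : ℝ} (ht : 0 < t) (hr : -1 < r) (w : ℂ) :
    Integrable (fun x : ℝ => ((|x| ^ r : ℝ) : ℂ) * cexp (-t * x ^ 2 + 2 * x * w)) := by
  refine ((integrable_abs_rpow_mul_gaussian (half_pos ht) hr).mul_const
    (Real.exp (2 * w.re ^ 2 / t))).mono' (by fun_prop) (Eventually.of_forall fun x => ?_)
  rw [norm_mul, norm_gaussian_exp, norm_real, Real.norm_of_nonneg (by positivity),
    mul_assoc (|x| ^ r), ← Real.exp_add]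
  exact mul_le_mul_of_nonneg_left (Real.exp_le_exp.2 (gaussian_exponent_le ht x w.re))
    (by positivity)

lemma integrable_abs_rpow_mul_cosh {t r : ℝ} (ht : 0 < t) (hr : -1 < r) (w : ℂ) :
    Integrable (fun x : ℝ => ((|x| ^ r * Real.exp (-t * x ^ 2) : ℝ) : ℂ) * cosh (2 * x * w)) := by
  refine (((integrable_abs_rpow_mul_exp ht hr w).add
    (integrable_abs_rpow_mul_exp ht hr (-w))).mul_const (1 / 2)).congr
    (Eventually.of_forall fun x => ?_)
  simp only [Pi.add_apply, cosh]
  push_cast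
  rw [Complex.exp_add, Complex.exp_add, mul_neg]
  ring

/-- The weight is even, so only the even part of `exp(2xw)` survives; this is why the result depends
on `w²` alone. -/
lemma integral_abs_rpow_mul_exp_eq_cosh {t r : ℝ} (ht : 0 < t) (hr : -1 < r) (w : ℂ) :
    ∫ x : ℝ, ((|x| ^ r : ℝ) : ℂ) * cexp (-t * x ^ 2 + 2 * x * w) =
      ∫ x : ℝ, ((|x| ^ r * Real.exp (-t * x ^ 2) : ℝ) : ℂ) * cosh (2 * x * w) := by
  have h1 := integral_neg_eq_self
    (fun x : ℝ => ((|x| ^ r : ℝ) : ℂ) * cexp (-t * x ^ 2 + 2 * x * w)) volume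
  have h2 : ∫ x : ℝ, ((|x| ^ r : ℝ) : ℂ) * cexp (-t * x ^ 2 + 2 * x * w) =
      ∫ x : ℝ, ((|x| ^ r : ℝ) : ℂ) * cexp (-t * x ^ 2 + 2 * x * (-w)) := by
    rw [← h1]
    refine integral_congr_ae (Eventually.of_forall fun x => ?_)
    simp
  have h3 := integral_add (integrable_abs_rpow_mul_exp ht hr w)
    (integrable_abs_rpow_mul_exp ht hr (-w))
  rw [← h2] at h3
  have h4 : ∀ z : ℂ, z = (z + z) * (1 / 2) := fun z => by ring
  rw [h4 (∫ x : ℝ, ((|x| ^ r : ℝ) : ℂ) * cexp (-t * x ^ 2 + 2 * x * w)), ← h3,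
    ← integral_mul_const]
  refine integral_congr_ae (Eventually.of_forall fun x => ?_)
  simp only [cosh]
  push_cast
  rw [Complex.exp_add, Complex.exp_add, mul_neg]
  ring

/-- The factor `x^(2k)` raises the moment from `r` to `r + 2k`. The Gamma recursion supplies the
numerator Pochhammer symbol, and `(2k)! = 4^k (1/2)_k k!` the denominator. -/
lemma integral_cosh_term {t r : ℝ} (ht : 0 < t) (hr : -1 < r) (w : ℂ) (k : ℕ) :
    ∫ x : ℝ, ((|x| ^ r * Real.exp (-t * x ^ 2) : ℝ) : ℂ) *
        ((2 * x * w) ^ (2 * k) / ((2 * k).factorial : ℂ)) =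
      ((t ^ (-(r + 1) / 2) * Real.Gamma ((r + 1) / 2) : ℝ) : ℂ) *
        ((ascPochhammer ℂ k).eval (((r : ℂ) + 1) / 2) /
          ((ascPochhammer ℂ k).eval (1 / 2) * (k.factorial : ℂ)) * (w ^ 2 / t) ^ k) := by
  have hrk : -1 < r + (2 * k : ℕ) := by
    have : (0 : ℝ) ≤ (2 * k : ℕ) := Nat.cast_nonneg _
    linarith
  have e1 : ∫ x : ℝ, ((|x| ^ r * Real.exp (-t * x ^ 2) : ℝ) : ℂ) *
        ((2 * x * w) ^ (2 * k) / ((2 * k).factorial : ℂ)) =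
      ∫ x : ℝ, ((|x| ^ (r + (2 * k : ℕ)) * Real.exp (-t * x ^ 2) : ℝ) : ℂ) *
        ((2 * w) ^ (2 * k) / ((2 * k).factorial : ℂ)) := by
    refine integral_congr_ae ?_
    filter_upwards [ae_ne_zero_real] with x hx
    rw [Real.rpow_add_natCast (abs_ne_zero.2 hx), pow_mul |x|, sq_abs, ← pow_mul]
    push_cast
    ring
  rw [e1, integral_mul_const, integral_complex_ofReal, integral_abs_rpow_mul_gaussian ht hrk]
  have e2 : Real.Gamma ((r + (2 * k : ℕ) + 1) / 2) =
      Real.Gamma ((r + 1) / 2) * (ascPochhammer ℝ k).eval ((r + 1) / 2) := by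
    clear e1 hrk
    induction k with
    | zero => simp
    | succ k ih =>
      have hpos : 0 < (r + (2 * k : ℕ) + 1) / 2 := by
        have : (0 : ℝ) ≤ (2 * k : ℕ) := Nat.cast_nonneg _
        linarith
      have : (r + (2 * (k + 1) : ℕ) + 1) / 2 = (r + (2 * k : ℕ) + 1) / 2 + 1 := by
        push_cast; ring
      rw [this, Real.Gamma_add_one hpos.ne', ih, ascPochhammer_succ_eval]
      push_cast
      ring
  have e3 : t ^ (-(r + (2 * k : ℕ) + 1) / 2) = t ^ (-(r + 1) / 2) / t ^ k := by
    rw [← Real.rpow_natCast t k, ← Real.rpow_sub ht]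
    congr 1
    push_cast
    ring
  have e4 : ((2 * k).factorial : ℂ) =
      4 ^ k * ((ascPochhammer ℂ k).eval (1 / 2) * (k.factorial : ℂ)) := by
    clear e1 hrk e2 e3
    induction k with
    | zero => simp
    | succ k ih =>
      have : 2 * (k + 1) = 2 * k + 1 + 1 := by ring
      rw [this, Nat.factorial_succ, Nat.factorial_succ, ascPochhammer_succ_eval, Nat.factorial_succ]
      push_cast
      rw [ih]
      ring
  have e5 : (ascPochhammer ℂ k).eval (((r : ℂ) + 1) / 2) =
      (((ascPochhammer ℝ k).eval ((r + 1) / 2) : ℝ) : ℂ) := by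
    clear e1 e2 e3 e4 hrk
    induction k with
    | zero => simp
    | succ k ih =>
      rw [ascPochhammer_succ_eval, ascPochhammer_succ_eval, ih]
      push_cast
      ring
  have hne : (ascPochhammer ℂ k).eval (1 / 2) * (k.factorial : ℂ) ≠ 0 := by
    intro h0
    rw [h0, mul_zero] at e4
    exact (Nat.cast_ne_zero.2 (Nat.factorial_ne_zero _)) e4
  have ht' : (t : ℂ) ≠ 0 := ofReal_ne_zero.2 ht.ne'
  rw [e2, e3, e4, e5]
  push_cast
  rw [mul_pow, pow_mul, pow_mul, div_pow]
  norm_num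
  field_simp

/-- The Gaussian moment integral in terms of the Kummer function. -/
theorem integral_abs_rpow_mul_exp {t r : ℝ} (ht : 0 < t) (hr : -1 < r) (w : ℂ) :
    ∫ x : ℝ, ((|x| ^ r : ℝ) : ℂ) * cexp (-t * x ^ 2 + 2 * x * w) =
      ((t ^ (-(r + 1) / 2) * Real.Gamma ((r + 1) / 2) : ℝ) : ℂ) *
        kummer (((r : ℂ) + 1) / 2) (1 / 2) (w ^ 2 / t) := by
  rw [integral_abs_rpow_mul_exp_eq_cosh ht hr, kummer, ← tsum_mul_left]
  simp_rw [← integral_cosh_term ht hr w]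
  refine (HasSum.tsum_eq ?_).symm
  -- The majorants sum to the same integrand at the real argument `‖w‖`, which is integrable.
  have hb (x : ℝ) : HasSum (fun n : ℕ => |x| ^ r * Real.exp (-t * x ^ 2) *
      ((2 * |x| * ‖w‖) ^ (2 * n) / ((2 * n).factorial : ℝ)))
      (|x| ^ r * Real.exp (-t * x ^ 2) * Real.cosh (2 * x * ‖w‖)) := by
    have := (Real.hasSum_cosh (2 * |x| * ‖w‖)).mul_left (|x| ^ r * Real.exp (-t * x ^ 2))
    rwa [← Real.cosh_abs (2 * |x| * ‖w‖), show |2 * |x| * ‖w‖| = |2 * x * ‖w‖| by simp [abs_mul],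
      Real.cosh_abs] at this
  refine hasSum_integral_of_dominated_convergence
    (fun n x => |x| ^ r * Real.exp (-t * x ^ 2) *
      ((2 * |x| * ‖w‖) ^ (2 * n) / ((2 * n).factorial : ℝ))) (fun n => by fun_prop) (fun n => ?_)
    (Eventually.of_forall fun x => (hb x).summable) ?_ (Eventually.of_forall fun x => ?_)
  · refine Eventually.of_forall fun x => le_of_eq ?_
    rw [norm_mul, norm_real, Real.norm_of_nonneg (by positivity), norm_div, norm_pow, norm_mul,
      norm_mul, norm_real, norm_natCast]
    simp
  · simp_rw [fun x => (hb x).tsum_eq]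
    have := (integrable_abs_rpow_mul_cosh ht hr (‖w‖ : ℂ)).re
    refine this.congr (Eventually.of_forall fun x => ?_)
    have e : cosh (2 * x * (‖w‖ : ℂ)) = ((Real.cosh (2 * x * ‖w‖) : ℝ) : ℂ) := by push_cast; rfl
    simp only [e, ← ofReal_mul]
    rfl
  · exact (hasSum_cosh (2 * x * w)).mul_left _

/-! ### Local regularity and decay of the moment density; the Dini condition. -/

/-- The density `|x|^r exp(-t x² + 2 p x)`. -/
noncomputable def momentDensity (t p r x : ℝ) : ℝ :=
  |x| ^ r * Real.exp (-t * x ^ 2 + 2 * x * p)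

lemma ofReal_momentDensity (t p r x : ℝ) : ((momentDensity t p r x : ℝ) : ℂ) =
    ((|x| ^ r : ℝ) : ℂ) * cexp (-t * x ^ 2 + 2 * x * p) := by
  unfold momentDensity
  push_cast
  rfl

lemma measurable_momentDensity (t p r : ℝ) : Measurable (momentDensity t p r) := by
  unfold momentDensity
  fun_prop

lemma integrable_momentDensity {t r : ℝ} (ht : 0 < t) (hr : -1 < r) (p : ℝ) :
    Integrable (momentDensity t p r) := by
  have := (integrable_abs_rpow_mul_exp ht hr p).re
  refine this.congr (Eventually.of_forall fun x => ?_)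
  simp only [← ofReal_momentDensity]
  rfl

lemma momentDensity_neg (t p r x : ℝ) : momentDensity t p r (-x) = momentDensity t (-p) r x := by
  simp [momentDensity]

lemma hasDerivAt_momentDensity {x : ℝ} (t p r : ℝ) (hx : 0 < x) :
    HasDerivAt (momentDensity t p r)
      (r * x ^ (r - 1) * Real.exp (-t * x ^ 2 + 2 * x * p) +
        x ^ r * (Real.exp (-t * x ^ 2 + 2 * x * p) * (-t * (2 * x) + 2 * p))) x := by
  have h1 : HasDerivAt (fun y : ℝ => y ^ r) (r * x ^ (r - 1)) x :=
    Real.hasDerivAt_rpow_const (Or.inl hx.ne')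
  have h2 : HasDerivAt (fun y : ℝ => -t * y ^ 2 + 2 * y * p) (-t * (2 * x) + 2 * p) x := by
    have := ((hasDerivAt_pow 2 x).const_mul (-t)).add (((hasDerivAt_id x).const_mul 2).mul_const p)
    refine this.congr_deriv ?_
    simp
  refine (h1.mul h2.exp).congr_of_eventuallyEq ?_
  filter_upwards [lt_mem_nhds hx] with y hy
  simp [momentDensity, abs_of_pos hy]

lemma differentiableAt_momentDensity {x : ℝ} (t p r : ℝ) (hx : x ≠ 0 ∨ r = 0) :
    DifferentiableAt ℝ (momentDensity t p r) x := by
  rcases hx with hx | rfl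
  · rcases lt_or_gt_of_ne hx with hx | hx
    · have h := (hasDerivAt_momentDensity t (-p) r (neg_pos.2 hx)).differentiableAt
      have h2 : momentDensity t p r = fun y => momentDensity t (-p) r (-y) := by
        funext y
        rw [momentDensity_neg, neg_neg]
      rw [h2]
      exact h.comp x differentiableAt_id.neg
    · exact (hasDerivAt_momentDensity t p r hx).differentiableAt
  · have : momentDensity t p 0 = fun x => Real.exp (-t * x ^ 2 + 2 * x * p) := by
      funext y
      simp [momentDensity]
    rw [this]
    fun_prop

/-- Where the density is differentiable, the slope is bounded near `a`. The remaining case is `a =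
0`, `r > 0`: there the slope is the density of exponent `r - 1 > -1`. For `r < 0` the slope at `0`
would not be integrable, whence `ha`. -/
lemma integrableOn_slope_momentDensity {t r a : ℝ} (ht : 0 < t) (hr : -1 < r) (p : ℝ)
    (ha : r < 0 → a ≠ 0) :
    IntegrableOn (fun y => |momentDensity t p r y - momentDensity t p r a| / |y - a|)
      (Set.Icc (a - 1 / 2) (a + 1 / 2)) := by
  have hmeas : Measurable
      (fun y => |momentDensity t p r y - momentDensity t p r a| / |y - a|) := by
    have := measurable_momentDensity t p r
    fun_prop
  by_cases hd : a ≠ 0 ∨ r = 0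
  · obtain ⟨C, hC⟩ := (differentiableAt_momentDensity t p r hd).isBigO_sub.bound
    obtain ⟨δ, hδ, hball⟩ := Metric.eventually_nhds_iff.1 hC
    have hbound : IntegrableOn (fun y => |C| +
        (|momentDensity t p r y| + |momentDensity t p r a|) * δ⁻¹)
        (Set.Icc (a - 1 / 2) (a + 1 / 2)) := by
      refine Integrable.add ?_ (Integrable.mul_const (Integrable.add ?_ ?_) _)
      · exact integrable_const _
      · exact (integrable_momentDensity ht hr p).abs.integrableOn
      · exact integrable_const _
    refine hbound.mono' hmeas.aestronglyMeasurable (Eventually.of_forall fun y => ?_)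
    rw [Real.norm_of_nonneg (by positivity)]
    by_cases hy : dist y a < δ
    · have h1 := hball hy
      simp only [Real.norm_eq_abs] at h1
      have h2 : |momentDensity t p r y - momentDensity t p r a| / |y - a| ≤ |C| := by
        refine div_le_of_le_mul₀ (abs_nonneg _) (abs_nonneg _) (h1.trans ?_)
        gcongr
        exact le_abs_self C
      have : 0 ≤ (|momentDensity t p r y| + |momentDensity t p r a|) * δ⁻¹ := by positivity
      linarith
    · have hy' : δ ≤ |y - a| := by simpa [Real.dist_eq] using hy
      have : |momentDensity t p r y - momentDensity t p r a| / |y - a| ≤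
          (|momentDensity t p r y| + |momentDensity t p r a|) * δ⁻¹ := by
        rw [← div_eq_mul_inv]
        gcongr
        exact abs_sub _ _
      linarith [abs_nonneg C]
  · push Not at hd
    obtain ⟨rfl, hr0⟩ := hd
    have hrpos : 0 < r := lt_of_le_of_ne (not_lt.1 fun h => ha h rfl) hr0.symm
    refine ((integrable_momentDensity ht (by linarith : -1 < r - 1) p).integrableOn).congr
      (MeasureTheory.ae_restrict_of_ae ?_)
    filter_upwards [ae_ne_zero_real] with y hy
    have hy' : 0 < |y| := abs_pos.2 hy
    have h0 : momentDensity t p r 0 = 0 := by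
      simp [momentDensity, Real.zero_rpow hr0]
    rw [h0, sub_zero, sub_zero, momentDensity, momentDensity, Real.rpow_sub_one hy'.ne',
      abs_of_nonneg (by positivity : 0 ≤ |y| ^ r * Real.exp (-t * y ^ 2 + 2 * y * p))]
    ring

/-- For `y ≥ 1/2` one has `|log y| ≤ y + 1`, so the power costs only a linear exponent; the constant
comes from completing the square. -/
lemma rpow_mul_exp_le {t : ℝ} (ht : 0 < t) (p s : ℝ) : ∃ C : ℝ, 0 ≤ C ∧ ∀ y : ℝ, 1 / 2 ≤ y →
    y ^ s * Real.exp (-t * y ^ 2 + 2 * y * p) ≤ C * Real.exp (-y) := by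
  refine ⟨Real.exp (|s| + (2 * p + 1 + |s|) ^ 2 / (4 * t)), by positivity, fun y hy => ?_⟩
  have hy0 : 0 < y := by linarith
  have hlog : |Real.log y| ≤ y + 1 := by
    rw [abs_le]
    constructor
    · have h1 := Real.log_le_sub_one_of_pos (inv_pos.2 hy0)
      rw [Real.log_inv] at h1
      have : y⁻¹ ≤ 2 := by
        rw [inv_le_comm₀ hy0 two_pos]
        linarith
      linarith
    · linarith [Real.log_le_sub_one_of_pos hy0]
  have h2 : Real.log y * s ≤ |s| * (y + 1) := by
    calc Real.log y * s ≤ |Real.log y * s| := le_abs_self _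
      _ = |s| * |Real.log y| := by rw [abs_mul, mul_comm]
      _ ≤ |s| * (y + 1) := by gcongr
  rw [Real.rpow_def_of_pos hy0, ← Real.exp_add, ← Real.exp_add]
  refine Real.exp_le_exp.2 ?_
  have h3 : 0 ≤ (2 * t * y - (2 * p + 1 + |s|)) ^ 2 / (4 * t) := by positivity
  have e : (2 * t * y - (2 * p + 1 + |s|)) ^ 2 / (4 * t) =
      t * y ^ 2 - (2 * p + 1 + |s|) * y + (2 * p + 1 + |s|) ^ 2 / (4 * t) := by
    field_simp
    ring
  linarith

lemma abs_deriv_momentDensity_le {t : ℝ} (ht : 0 < t) (p r : ℝ) : ∃ C : ℝ, 0 ≤ C ∧ ∀ y : ℝ,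
    1 / 2 ≤ y →
    |r * y ^ (r - 1) * Real.exp (-t * y ^ 2 + 2 * y * p) +
        y ^ r * (Real.exp (-t * y ^ 2 + 2 * y * p) * (-t * (2 * y) + 2 * p))| ≤
      C * Real.exp (-y) := by
  obtain ⟨A, hA0, hA⟩ := rpow_mul_exp_le ht p (r - 1)
  obtain ⟨B, hB0, hB⟩ := rpow_mul_exp_le ht p r
  obtain ⟨D, hD0, hD⟩ := rpow_mul_exp_le ht p (r + 1)
  refine ⟨|r| * A + |2 * t| * D + |2 * p| * B, by positivity, fun y hy => ?_⟩
  have hy0 : 0 < y := by linarith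
  set E := Real.exp (-t * y ^ 2 + 2 * y * p) with hE
  have hE0 : 0 < E := Real.exp_pos _
  have e : r * y ^ (r - 1) * E + y ^ r * (E * (-t * (2 * y) + 2 * p)) =
      r * (y ^ (r - 1) * E) + (-(2 * t)) * (y ^ (r + 1) * E) + 2 * p * (y ^ r * E) := by
    rw [Real.rpow_add_one hy0.ne']
    ring
  rw [e]
  refine (abs_add_three _ _ _).trans ?_
  rw [abs_mul r, abs_mul (-(2 * t)), abs_mul (2 * p) (_ * _), abs_neg,
    abs_of_nonneg (by positivity : 0 ≤ y ^ (r - 1) * E),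
    abs_of_nonneg (by positivity : 0 ≤ y ^ (r + 1) * E), abs_of_nonneg (by positivity : 0 ≤ y ^ r * E),
    add_mul, add_mul, mul_assoc, mul_assoc, mul_assoc |2 * p|]
  exact add_le_add (add_le_add (mul_le_mul_of_nonneg_left (hA y hy) (abs_nonneg _))
    (mul_le_mul_of_nonneg_left (hD y hy) (abs_nonneg _)))
    (mul_le_mul_of_nonneg_left (hB y hy) (abs_nonneg _))

lemma momentDensity_sub_le_of_pos {t : ℝ} (ht : 0 < t) (p r : ℝ) : ∃ C : ℝ, 0 ≤ C ∧ ∀ a y : ℝ,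
    1 ≤ a → |y - a| ≤ 1 / 2 →
    |momentDensity t p r y - momentDensity t p r a| ≤ C * Real.exp (-|y|) * |y - a| := by
  obtain ⟨C, hC0, hC⟩ := abs_deriv_momentDensity_le ht p r
  -- The factor `exp(1/2)` pays for evaluating the derivative bound at an intermediate `z ≥ y - 1/2`
  -- instead of at `y`.
  refine ⟨C * Real.exp (1 / 2), by positivity, fun a y ha hy => ?_⟩
  obtain ⟨hy1, hy2⟩ := abs_le.1 hy
  have hmem : ∀ z ∈ Set.uIcc a y, 1 / 2 ≤ z ∧ y - 1 / 2 ≤ z := by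
    intro z hz
    have := hz.1
    constructor
    · exact le_trans (le_min (by linarith) (by linarith)) this
    · exact le_trans (le_min (by linarith) (by linarith)) this
  have hypos : 0 < y := by linarith
  rw [abs_of_pos hypos]
  refine Convex.norm_image_sub_le_of_norm_hasDerivWithin_le (s := Set.uIcc a y)
    (fun z hz => (hasDerivAt_momentDensity t p r
      (by linarith [(hmem z hz).1])).hasDerivWithinAt) (fun z hz => ?_) (convex_uIcc a y)
    Set.left_mem_uIcc Set.right_mem_uIcc
  refine (hC z (hmem z hz).1).trans ?_
  rw [mul_assoc, ← Real.exp_add]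
  gcongr
  linarith [(hmem z hz).2]

/-- One integrable weight controls every cell whose centre has modulus at least 1, leaving only
finitely many cells to treat individually. -/
lemma momentDensity_sub_le {t : ℝ} (ht : 0 < t) (p r : ℝ) : ∃ C : ℝ, 0 ≤ C ∧ ∀ a y : ℝ,
    1 ≤ |a| → |y - a| ≤ 1 / 2 →
    |momentDensity t p r y - momentDensity t p r a| ≤ C * Real.exp (-|y|) * |y - a| := by
  obtain ⟨C, hC0, hC⟩ := momentDensity_sub_le_of_pos ht p r
  obtain ⟨D, hD0, hD⟩ := momentDensity_sub_le_of_pos ht (-p) r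
  refine ⟨C + D, by positivity, fun a y ha hy => ?_⟩
  rcases le_abs.1 ha with h | h
  · refine (hC a y h hy).trans ?_
    gcongr
    linarith
  · have hs : |-y - -a| = |y - a| := by rw [← abs_neg]; congr 1; ring
    have := hD (-a) (-y) h (hs.le.trans hy)
    rw [momentDensity_neg, momentDensity_neg, neg_neg, hs, abs_neg] at this
    refine this.trans ?_
    gcongr
    linarith

/-- Jordan's inequality for `2|sin(πs)|` with `s = x - round x`, `|s| ≤ 1/2`. -/
lemma four_mul_abs_sub_round_le (x : ℝ) :
    4 * |x - round x| ≤ ‖cexp (-2 * Real.pi * I * x) - 1‖ := by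
  set s := x - round x with hs
  have e : cexp (-2 * Real.pi * I * x) = cexp (I * ((-2 * Real.pi * s : ℝ) : ℂ)) := by
    rw [exp_eq_exp_iff_exists_int]
    refine ⟨-round x, ?_⟩
    rw [hs]
    push_cast
    ring
  rw [e, norm_exp_I_mul_ofReal_sub_one, Real.norm_eq_abs, abs_mul, abs_two]
  have h1 : |s| ≤ 1 / 2 := abs_sub_round x
  have h2 : |-2 * Real.pi * s / 2| = Real.pi * |s| := by
    rw [show -2 * Real.pi * s / 2 = -(Real.pi * s) by ring, abs_neg, abs_mul,
      abs_of_pos Real.pi_pos]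
  have h3 := Real.mul_abs_le_abs_sin (x := -2 * Real.pi * s / 2)
    (by rw [h2]; nlinarith [Real.pi_pos])
  rw [h2] at h3
  have : 2 / Real.pi * (Real.pi * |s|) = 2 * |s| := by
    have := Real.pi_ne_zero
    field_simp
  linarith

/-- The Dini condition of the Poisson summation formula for the shifted moment density. -/
theorem integrable_dini_momentDensity {t r ζ : ℝ} (ht : 0 < t) (hr : -1 < r) (p : ℝ)
    (hζ : r < 0 → ∀ n : ℤ, ζ ≠ (n : ℝ)) :
    Integrable (fun x : ℝ => (((momentDensity t p r (x + ζ) : ℝ) : ℂ) -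
      ((momentDensity t p r (((round x : ℤ) : ℝ) + ζ) : ℝ) : ℂ)) /
        (cexp (-2 * Real.pi * I * x) - 1)) := by
  obtain ⟨C, hC0, hC⟩ := momentDensity_sub_le ht p r
  let q : ℤ → ℝ → ℝ := fun n => (Set.Icc ((n + ζ) - 1 / 2) ((n + ζ) + 1 / 2)).indicator
    (fun y => |momentDensity t p r y - momentDensity t p r (n + ζ)| / |y - (n + ζ)|)
  have hq0 (n : ℤ) (y : ℝ) : 0 ≤ q n y := Set.indicator_nonneg (fun y _ => by positivity) y
  have hq (n : ℤ) : Integrable (q n) := by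
    refine (integrable_indicator_iff measurableSet_Icc).2
      (integrableOn_slope_momentDensity ht hr p fun h h0 => hζ h (-n) ?_)
    push_cast
    linarith
  -- A finite set containing every `n` with `|n + ζ| < 1`.
  set F : Finset ℤ := Finset.Icc ⌊-ζ - 1⌋ ⌈-ζ + 1⌉
  have hexp : Integrable (fun y : ℝ => Real.exp (-|y|)) := by
    refine integrable_comp_abs (f := fun y => Real.exp (-y)) ?_
    simpa using exp_neg_integrableOn_Ioi 0 one_pos
  have hbound : Integrable (fun x : ℝ => C * Real.exp (-|x + ζ|) + ∑ n ∈ F, q n (x + ζ)) :=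
    ((hexp.comp_add_right ζ).const_mul C).add
      (integrable_finsetSum _ fun n _ => (hq n).comp_add_right ζ)
  refine hbound.mono' ?_ (Eventually.of_forall fun x => ?_)
  · refine Measurable.aestronglyMeasurable ?_
    have h1 := measurable_momentDensity t p r
    have h2 : Measurable (fun x : ℝ => ((round x : ℤ) : ℝ)) := by
      simp_rw [round_eq]
      fun_prop
    fun_prop
  · set n := round x with hn
    have hx : |x + ζ - (n + ζ)| ≤ 1 / 2 := by
      rw [add_sub_add_right_eq_sub]
      exact abs_sub_round x
    have hle : ‖(((momentDensity t p r (x + ζ) : ℝ) : ℂ) -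
        ((momentDensity t p r ((n : ℝ) + ζ) : ℝ) : ℂ)) / (cexp (-2 * Real.pi * I * x) - 1)‖ ≤
        |momentDensity t p r (x + ζ) - momentDensity t p r (n + ζ)| / |x + ζ - (n + ζ)| := by
      rw [norm_div, ← ofReal_sub, norm_real, Real.norm_eq_abs]
      by_cases h0 : x + ζ - (n + ζ) = 0
      · have : x + ζ = n + ζ := by linarith
        rw [this]
        simp
      · have := four_mul_abs_sub_round_le x
        have h1 : 0 < |x + ζ - (n + ζ)| := abs_pos.2 h0
        gcongr
        rw [add_sub_add_right_eq_sub] at h1 ⊢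
        rw [← hn] at this
        linarith
    refine hle.trans ?_
    have hsum0 : 0 ≤ ∑ m ∈ F, q m (x + ζ) := Finset.sum_nonneg fun m _ => hq0 m _
    by_cases hbig : 1 ≤ |(n : ℝ) + ζ|
    · have : |momentDensity t p r (x + ζ) - momentDensity t p r (n + ζ)| / |x + ζ - (n + ζ)| ≤
          C * Real.exp (-|x + ζ|) :=
        div_le_of_le_mul₀ (abs_nonneg _) (by positivity) (hC _ _ hbig hx)
      linarith
    · have hnF : n ∈ F := by
        obtain ⟨h1, h2⟩ := abs_lt.1 (not_le.1 hbig)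
        rw [Finset.mem_Icc]
        constructor
        · have : ((⌊-ζ - 1⌋ : ℤ) : ℝ) ≤ n := (Int.floor_le _).trans (by linarith)
          exact_mod_cast this
        · have : (n : ℝ) ≤ ((⌈-ζ + 1⌉ : ℤ) : ℝ) := le_trans (by linarith) (Int.le_ceil _)
          exact_mod_cast this
      have h1 := Finset.single_le_sum (fun m _ => hq0 m (x + ζ)) hnF
      have h2 : q n (x + ζ) =
          |momentDensity t p r (x + ζ) - momentDensity t p r (n + ζ)| / |x + ζ - (n + ζ)| := by
        refine Set.indicator_of_mem ?_ _
        obtain ⟨h3, h4⟩ := abs_le.1 hx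
        exact ⟨by linarith, by linarith⟩
      have : 0 ≤ C * Real.exp (-|x + ζ|) := by positivity
      linarith

/-! ### Plane waves and spectral projections of the momentum operator. -/

lemma integral_circleMeasure (f : ℝ → ℂ) :
    ∫ φ, f φ ∂circleMeasure = (2 * Real.pi : ℂ)⁻¹ * ∫ φ in (0 : ℝ)..(2 * Real.pi), f φ := by
  have := Real.pi_pos
  unfold circleMeasure
  rw [integral_smul_measure, ENNReal.toReal_ofReal (by positivity),
    intervalIntegral.integral_of_le (by positivity), real_smul]
  push_cast
  rfl

/-- The plane wave `exp(i (n + ζ) φ)`. -/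
noncomputable def planeWave (ζ : ℝ) (n : ℤ) : BoundedContinuousFunction ℝ ℂ :=
  BoundedContinuousFunction.ofNormedAddCommGroup
    (fun φ : ℝ => cexp (I * ((n : ℂ) + ζ) * φ)) (by fun_prop) 1 (fun φ => by
      have : I * ((n : ℂ) + ζ) * φ = (((n + ζ) * φ : ℝ) : ℂ) * I := by push_cast; ring
      rw [this, norm_exp_ofReal_mul_I])

lemma planeWave_apply (ζ : ℝ) (n : ℤ) (φ : ℝ) :
    planeWave ζ n φ = cexp (I * ((n : ℂ) + ζ) * φ) := rfl

lemma norm_planeWave_le (ζ : ℝ) (n : ℤ) : ‖planeWave ζ n‖ ≤ 1 :=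
  BoundedContinuousFunction.norm_ofNormedAddCommGroup_le _ zero_le_one _

/-- The plane wave as a vector of `L₂(S¹)`. -/
noncomputable def planeWaveVec (ζ : ℝ) (n : ℤ) : CircleL2 :=
  BoundedContinuousFunction.toLp 2 circleMeasure ℂ (planeWave ζ n)

lemma coeFn_planeWaveVec (ζ : ℝ) (n : ℤ) :
    (planeWaveVec ζ n : ℝ → ℂ) =ᵐ[circleMeasure] fun φ : ℝ => cexp (I * ((n : ℂ) + ζ) * φ) :=
  BoundedContinuousFunction.coeFn_toLp (𝕜 := ℂ) (p := 2) (μ := circleMeasure) (planeWave ζ n)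

lemma conj_planeWave (ζ : ℝ) (n : ℤ) (φ : ℝ) :
    (starRingEnd ℂ) (cexp (I * ((n : ℂ) + ζ) * φ)) = cexp (-(I * ((n : ℂ) + ζ)) * φ) := by
  rw [← exp_conj]
  congr 1
  simp

lemma inner_planeWaveVec (ζ : ℝ) (n : ℤ) (ψ : CircleL2) :
    inner ℂ (planeWaveVec ζ n) ψ = (2 * Real.pi : ℂ)⁻¹ *
      ∫ φ in (0 : ℝ)..(2 * Real.pi), cexp (-(I * ((n : ℂ) + ζ)) * φ) * ψ φ := by
  rw [L2.inner_def, ← integral_circleMeasure]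
  refine integral_congr_ae ?_
  filter_upwards [coeFn_planeWaveVec ζ n] with φ hφ
  rw [hφ, RCLike.inner_apply, conj_planeWave, mul_comm]

lemma exp_planeWave_two_pi (ζ : ℝ) (n : ℤ) :
    cexp (I * ((n : ℂ) + ζ) * ((2 * Real.pi : ℝ) : ℂ)) = cexp (2 * Real.pi * I * ζ) := by
  rw [exp_eq_exp_iff_exists_int]
  exact ⟨n, by push_cast; ring⟩

lemma hasDerivAt_exp_mul (c : ℂ) (x : ℝ) :
    HasDerivAt (fun φ : ℝ => cexp (c * φ)) (c * cexp (c * x)) x := by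
  have := ((hasDerivAt_id (x : ℂ)).const_mul c).cexp.comp_ofReal
  simpa [mul_comm] using this

lemma planeWaveVec_mem_eigenspace {t : ℝ} (ht : 0 < t) (ζ : ℝ) (n : ℤ) :
    planeWaveVec ζ n ∈ eigenspace (momentum t ζ) (t * (n + ζ)) := by
  have ht' : (t : ℂ) ≠ 0 := ofReal_ne_zero.2 ht.ne'
  refine ⟨fun φ => cexp (I * ((n : ℂ) + ζ) * φ), coeFn_planeWaveVec ζ n, ?_, fun φ hφ => ?_⟩
  · simp only [exp_planeWave_two_pi]
    simp
  · have h1 : ∫ s in (0 : ℝ)..φ, (((t * (n + ζ) : ℝ) : ℂ) • planeWaveVec ζ n : CircleL2) s =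
        ∫ s in (0 : ℝ)..φ, ((t * (n + ζ) : ℝ) : ℂ) * cexp (I * ((n : ℂ) + ζ) * s) := by
      refine integral_congr_circle ((Lp.coeFn_smul _ _).trans ?_) hφ
      filter_upwards [coeFn_planeWaveVec ζ n] with s hs
      rw [Pi.smul_apply, hs, smul_eq_mul]
    have h2 := intervalIntegral.integral_eq_sub_of_hasDerivAt (a := 0) (b := φ)
      (fun x _ => hasDerivAt_exp_mul (I * ((n : ℂ) + ζ)) x)
      (Continuous.intervalIntegrable (by fun_prop) _ _)
    rw [intervalIntegral.integral_const_mul] at h2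
    change _ = _ + I / t * ∫ s in (0 : ℝ)..φ,
      (((t * (n + ζ) : ℝ) : ℂ) • planeWaveVec ζ n : CircleL2) s
    rw [h1, intervalIntegral.integral_const_mul]
    push_cast
    have : I / t * (t * (n + ζ) * ∫ s in (0 : ℝ)..φ, cexp (I * ((n : ℂ) + ζ) * s)) =
        I * (n + ζ) * ∫ s in (0 : ℝ)..φ, cexp (I * ((n : ℂ) + ζ) * s) := by
      field_simp
    rw [this, h2]
    simp

/-- Eigenvectors of the momentum operator are orthogonal to the plane waves with a different
momentum. -/
lemma inner_planeWaveVec_of_mem_eigenspace {t μ ζ : ℝ} (ht : 0 < t) {n : ℤ} {ψ : CircleL2}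
    (hψ : ψ ∈ eigenspace (momentum t ζ) μ) (hμ : μ ≠ t * (n + ζ)) :
    inner ℂ (planeWaveVec ζ n) ψ = 0 := by
  have ht' : (t : ℂ) ≠ 0 := ofReal_ne_zero.2 ht.ne'
  have hpi : (0 : ℝ) ≤ 2 * Real.pi := by positivity
  obtain ⟨u, hu, hbd, hint⟩ := hψ
  change (ψ : ℝ → ℂ) =ᵐ[circleMeasure] u at hu
  change ∀ φ ∈ Set.Icc (0 : ℝ) (2 * Real.pi), u φ = u 0 + (I / t) *
    ∫ s in (0 : ℝ)..φ, (((μ : ℂ) • ψ : CircleL2) : ℝ → ℂ) s at hint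
  have hint' : ∀ φ ∈ Set.Icc (0 : ℝ) (2 * Real.pi),
      u φ = u 0 + (I * μ / t) * ∫ s in (0 : ℝ)..φ, (ψ : ℝ → ℂ) s := by
    intro φ hφ
    rw [hint φ hφ, integral_congr_circle (Lp.coeFn_smul _ _) hφ]
    simp only [Pi.smul_apply, smul_eq_mul]
    rw [intervalIntegral.integral_const_mul]
    ring
  have hcont : ContinuousOn u (Set.Icc 0 (2 * Real.pi)) := by
    have h1 := intervalIntegral.continuousOn_primitive_interval' (a := 0)
      (intervalIntegrable_coe ψ (Set.right_mem_Icc.2 hpi)) Set.left_mem_uIcc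
    rw [Set.uIcc_of_le hpi] at h1
    exact (continuousOn_const.add (continuousOn_const.mul h1)).congr hint'
  -- Only the values of `u` on `[0, 2π]` are constrained. Extending them continuously makes the
  -- primitive `U` differentiable on all of `ℝ`, so integration by parts applies.
  set v : ℝ → ℂ := Set.IccExtend hpi ((Set.Icc 0 (2 * Real.pi)).domRestrict u) with hv
  have hvc : Continuous v := hcont.domRestrict.Icc_extend'
  have hvu : ∀ φ ∈ Set.Icc (0 : ℝ) (2 * Real.pi), v φ = u φ := fun φ hφ => by
    rw [hv, Set.IccExtend_of_mem hpi _ hφ]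
    rfl
  have hψv : (ψ : ℝ → ℂ) =ᵐ[volume.restrict (Set.Ioc 0 (2 * Real.pi))] v := by
    filter_upwards [ae_restrict_of_ae hu, ae_restrict_mem measurableSet_Ioc] with s hs hs'
    rw [hs, hvu s ⟨hs'.1.le, hs'.2⟩]
  have hψv' : ∀ φ ∈ Set.Icc (0 : ℝ) (2 * Real.pi),
      ∫ s in (0 : ℝ)..φ, (ψ : ℝ → ℂ) s = ∫ s in (0 : ℝ)..φ, v s := by
    intro φ hφ
    rw [intervalIntegral.integral_of_le hφ.1, intervalIntegral.integral_of_le hφ.1]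
    exact integral_congr_ae
      (ae_restrict_of_ae_restrict_of_subset (Set.Ioc_subset_Ioc_right hφ.2) hψv)
  set U : ℝ → ℂ := fun φ => u 0 + (I * μ / t) * ∫ s in (0 : ℝ)..φ, v s with hU
  have hUu : ∀ φ ∈ Set.Icc (0 : ℝ) (2 * Real.pi), U φ = u φ := fun φ hφ => by
    rw [hint' φ hφ, hψv' φ hφ]
  have hUd (x : ℝ) : HasDerivAt U (I * μ / t * v x) x :=
    ((hvc.integral_hasStrictDerivAt 0 x).hasDerivAt.const_mul _).const_add _
  have hUc : Continuous U := continuous_iff_continuousAt.2 fun x => (hUd x).continuousAt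
  have hftc := intervalIntegral.integral_eq_sub_of_hasDerivAt (a := 0) (b := 2 * Real.pi)
    (fun x _ => (hasDerivAt_exp_mul (-(I * ((n : ℂ) + ζ))) x).mul (hUd x))
    (Continuous.intervalIntegrable (by fun_prop) _ _)
  -- The boundary terms cancel because `u` and the plane wave acquire the same factor `exp(2πiζ)`.
  have hright : (fun φ : ℝ => cexp (-(I * ((n : ℂ) + ζ)) * φ)) (2 * Real.pi) * U (2 * Real.pi) -
      (fun φ : ℝ => cexp (-(I * ((n : ℂ) + ζ)) * φ)) 0 * U 0 = 0 := by
    simp only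
    rw [hUu _ (Set.right_mem_Icc.2 hpi), hUu _ (Set.left_mem_Icc.2 hpi), hbd, neg_mul,
      Complex.exp_neg, exp_planeWave_two_pi, inv_mul_cancel_left₀ (Complex.exp_ne_zero _)]
    simp
  have hleft : ∫ x in (0 : ℝ)..(2 * Real.pi), (-(I * ((n : ℂ) + ζ)) *
        cexp (-(I * ((n : ℂ) + ζ)) * x) * U x +
        cexp (-(I * ((n : ℂ) + ζ)) * x) * (I * μ / t * v x)) =
      (I * μ / t - I * (n + ζ)) *
        ∫ x in (0 : ℝ)..(2 * Real.pi), cexp (-(I * ((n : ℂ) + ζ)) * x) * ψ x := by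
    rw [← intervalIntegral.integral_const_mul, intervalIntegral.integral_of_le hpi,
      intervalIntegral.integral_of_le hpi]
    refine integral_congr_ae ?_
    filter_upwards [hψv, ae_restrict_mem measurableSet_Ioc] with x hx hx'
    rw [hx, hUu x ⟨hx'.1.le, hx'.2⟩, hvu x ⟨hx'.1.le, hx'.2⟩]
    ring
  have hzero : (I * μ / t - I * (n + ζ)) *
      ∫ x in (0 : ℝ)..(2 * Real.pi), cexp (-(I * ((n : ℂ) + ζ)) * x) * ψ x = 0 := by
    rw [← hleft, ← hright]
    exact hftc
  have hne : (I * μ / t - I * (n + ζ) : ℂ) ≠ 0 := by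
    intro h0
    apply hμ
    have h1 : (μ : ℂ) = t * (n + ζ) := by
      have : I * ((μ : ℂ) - t * (n + ζ)) = 0 := by
        field_simp at h0
        linear_combination h0
      have := (mul_eq_zero.1 this).resolve_left I_ne_zero
      linear_combination this
    exact_mod_cast h1
  rw [inner_planeWaveVec, (mul_eq_zero.1 hzero).resolve_left hne, mul_zero]

lemma momentum_eigenvalue_injective {t : ℝ} (ht : 0 < t) (ζ : ℝ) :
    Function.Injective (fun n : ℤ => t * ((n : ℝ) + ζ)) := by
  intro m n h
  have := mul_left_cancel₀ ht.ne' h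
  exact_mod_cast add_right_cancel this

lemma orthonormal_planeWaveVec (ζ : ℝ) : Orthonormal ℂ (planeWaveVec ζ) := by
  rw [orthonormal_iff_ite]
  intro m n
  split_ifs with h
  · subst h
    rw [inner_planeWaveVec]
    have : ∫ φ in (0 : ℝ)..(2 * Real.pi),
        cexp (-(I * ((m : ℂ) + ζ)) * φ) * planeWaveVec ζ m φ =
        ∫ φ in (0 : ℝ)..(2 * Real.pi), (1 : ℂ) := by
      refine integral_congr_circle ?_ ⟨by positivity, le_rfl⟩
      filter_upwards [coeFn_planeWaveVec ζ m] with φ hφ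
      rw [hφ, ← Complex.exp_add]
      simp
    rw [this, intervalIntegral.integral_const]
    have := ofReal_ne_zero.2 Real.pi_ne_zero
    simp only [sub_zero, real_smul, mul_one]
    push_cast
    field_simp
  -- The plane waves do not depend on `t`, so `t = 1` suffices to separate eigenvalues.
  · refine inner_planeWaveVec_of_mem_eigenspace one_pos (planeWaveVec_mem_eigenspace one_pos ζ n) ?_
    intro h'
    exact h (momentum_eigenvalue_injective one_pos ζ h').symm

/-- Membership in one eigenspace and orthogonality to all the others suffice; neither completeness
of the plane waves nor simplicity of the eigenvalues enters. -/
lemma spectralProj_planeWaveVec {t : ℝ} (ht : 0 < t) (ζ μ : ℝ) (n : ℤ) :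
    spectralProj (momentum t ζ) μ (planeWaveVec ζ n) =
      if μ = t * (n + ζ) then planeWaveVec ζ n else 0 := by
  unfold spectralProj
  split_ifs with h
  · subst h
    rw [Submodule.starProjection_eq_self_iff]
    exact Submodule.le_topologicalClosure _ (planeWaveVec_mem_eigenspace ht ζ n)
  · rw [Submodule.starProjection_apply_eq_zero_iff, Submodule.orthogonal_closure,
      Submodule.mem_orthogonal']
    intro ψ hψ
    exact inner_planeWaveVec_of_mem_eigenspace ht hψ h

/-! ### Plane-wave expansion of the coherent state. -/

lemma coherentTerm_eq (t θ₀ p ζ : ℝ) (n : ℤ) (φ : ℝ) :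
    coherentTerm t θ₀ p ζ n φ = coherentTerm t θ₀ p ζ n 0 * planeWave ζ n φ := by
  rw [planeWave_apply]
  unfold coherentTerm
  rw [mul_assoc (cexp _), ← Complex.exp_add (I * _ * _)]
  congr 2
  push_cast
  ring

/-- The expansion of the coherent state in plane waves. -/
theorem hasSum_coherentState {t : ℝ} (ht : 0 < t) (θ₀ p ζ : ℝ) :
    HasSum (fun n : ℤ => coherentTerm t θ₀ p ζ n 0 • planeWaveVec ζ n)
      (coherentState ht θ₀ p ζ) := by
  -- Summing in the sup norm lets both point evaluation and the map to `L₂` pass through the series.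
  have hs : Summable (fun n : ℤ => coherentTerm t θ₀ p ζ n 0 • planeWave ζ n) := by
    refine Summable.of_norm_bounded (summable_coherentBound ht p ζ) fun n => ?_
    rw [norm_smul, norm_coherentTerm]
    exact mul_le_of_le_one_right (Real.exp_pos _).le (norm_planeWave_le ζ n)
  have hval (φ : ℝ) : (∑' n : ℤ, coherentTerm t θ₀ p ζ n 0 • planeWave ζ n) φ =
      coherentFun t θ₀ p ζ φ := by
    have h1 := (BoundedContinuousFunction.evalCLM ℂ φ).hasSum hs.hasSum
    refine Eq.trans ?_ ((h1.tsum_eq).symm.trans (tsum_congr fun n => ?_))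
    · rfl
    · rw [coherentTerm_eq t θ₀ p ζ n φ]
      rfl
  have h2 := (BoundedContinuousFunction.toLp (E := ℂ) 2 circleMeasure ℂ).hasSum hs.hasSum
  have h3 : BoundedContinuousFunction.toLp (E := ℂ) 2 circleMeasure ℂ
      (∑' n : ℤ, coherentTerm t θ₀ p ζ n 0 • planeWave ζ n) = coherentState ht θ₀ p ζ := by
    refine Lp.ext ?_
    refine (BoundedContinuousFunction.coeFn_toLp (𝕜 := ℂ) (p := 2) (μ := circleMeasure) _).trans ?_
    refine EventuallyEq.trans (Eventually.of_forall hval) ?_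
    exact (MemLp.coeFn_toLp (memLp_coherentFun ht θ₀ p ζ)).symm
  rw [h3] at h2
  refine h2.congr_fun ?_
  intro n
  simp [planeWaveVec]

lemma spectralProj_coherentState {t : ℝ} (ht : 0 < t) (θ₀ p ζ : ℝ) (m : ℤ) :
    spectralProj (momentum t ζ) (t * (m + ζ)) (coherentState ht θ₀ p ζ) =
      coherentTerm t θ₀ p ζ m 0 • planeWaveVec ζ m := by
  have h := (spectralProj (momentum t ζ) (t * (m + ζ))).hasSum (hasSum_coherentState ht θ₀ p ζ)
  refine h.unique ?_
  convert hasSum_single m ?_ using 1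
  · simp [spectralProj_planeWaveVec ht]
  · intro n hn
    have : t * ((m : ℝ) + ζ) ≠ t * (n + ζ) :=
      fun h' => hn (momentum_eigenvalue_injective ht ζ h').symm
    simp [spectralProj_planeWaveVec ht, this]

lemma spectralProj_coherentState_eq_zero {t μ : ℝ} (ht : 0 < t) (θ₀ p ζ : ℝ)
    (hμ : μ ∉ Set.range (fun n : ℤ => t * ((n : ℝ) + ζ))) :
    spectralProj (momentum t ζ) μ (coherentState ht θ₀ p ζ) = 0 := by
  have h := (spectralProj (momentum t ζ) μ).hasSum (hasSum_coherentState ht θ₀ p ζ)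
  refine h.unique ?_
  convert hasSum_zero using 1
  funext n
  have : μ ≠ t * (n + ζ) := fun h' => hμ ⟨n, h'.symm⟩
  simp [spectralProj_planeWaveVec ht, this]

lemma inner_coherentState_planeWaveVec {t : ℝ} (ht : 0 < t) (θ₀ p ζ : ℝ) (n : ℤ) :
    inner ℂ (coherentState ht θ₀ p ζ) (planeWaveVec ζ n) =
      (starRingEnd ℂ) (coherentTerm t θ₀ p ζ n 0) := by
  have h := (innerSL ℂ (planeWaveVec ζ n)).hasSum (hasSum_coherentState ht θ₀ p ζ)
  have h2 : inner ℂ (planeWaveVec ζ n) (coherentState ht θ₀ p ζ) = coherentTerm t θ₀ p ζ n 0 := by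
    refine h.unique ?_
    convert hasSum_single n ?_ using 1
    · simp [(orthonormal_planeWaveVec ζ).1 n]
    · intro m hm
      simp [orthonormal_iff_ite.1 (orthonormal_planeWaveVec ζ), hm.symm]
  rw [← inner_conj_symm, h2]

lemma hasSum_inner_coherentState {t : ℝ} (ht : 0 < t) (θ₀ p ζ : ℝ) {a : ℤ → ℝ} {χ : CircleL2}
    (h : HasSum (fun n : ℤ => (a n : ℂ) • coherentTerm t θ₀ p ζ n 0 • planeWaveVec ζ n) χ) :
    HasSum (fun n : ℤ => ((a n * Real.exp (-t * ((n : ℝ) + ζ) ^ 2 + 2 * ((n : ℝ) + ζ) * p) : ℝ) : ℂ))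
      (inner ℂ (coherentState ht θ₀ p ζ) χ) := by
  have h2 := (innerSL ℂ (coherentState ht θ₀ p ζ)).hasSum h
  refine h2.congr_fun fun n => ?_
  simp only [innerSL_apply_apply, inner_smul_right, inner_coherentState_planeWaveVec, mul_conj,
    normSq_eq_norm_sq, norm_coherentTerm]
  rw [← Real.exp_nat_mul]
  push_cast
  congr 2
  ring

/-! ### Poisson summation for the moments, and the domain of `|p̂|^r`. -/

lemma HasBilateralSum.mul_left {f : ℤ → ℂ} {S : ℂ} (c : ℂ) (hf : HasBilateralSum f S) :
    HasBilateralSum (fun N => c * f N) (c * S) := by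
  unfold HasBilateralSum at *
  simpa only [Finset.mul_sum] using hf.const_mul c

lemma poisson_momentDensity {t r ζ : ℝ} (ht : 0 < t) (hr : -1 < r) (p : ℝ)
    (hζ : r < 0 → ∀ n : ℤ, ζ ≠ (n : ℝ)) :
    ∃ S : ℂ, HasSum (fun n : ℤ => ((momentDensity t p r (n + ζ) : ℝ) : ℂ)) S ∧
      HasBilateralSum (fourierInt fun x => ((momentDensity t p r (x + ζ) : ℝ) : ℂ)) S :=
  poisson_of_dini (h := fun x => ((momentDensity t p r (x + ζ) : ℝ) : ℂ))
    ((integrable_momentDensity ht hr p).comp_add_right ζ).ofReal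
    (integrable_dini_momentDensity ht hr p hζ)

lemma summable_momentDensity {t r ζ : ℝ} (ht : 0 < t) (hr : -1 < r) (p : ℝ)
    (hζ : r < 0 → ∀ n : ℤ, ζ ≠ (n : ℝ)) :
    Summable (fun n : ℤ => momentDensity t p r (n + ζ)) := by
  obtain ⟨S, hS, -⟩ := poisson_momentDensity ht hr p hζ
  exact summable_ofReal.1 hS.summable

/-- Translation by `ζ` produces the phase; the character joins the linear term of the exponent,
replacing `p` by `p - πiN`. -/
lemma fourierInt_momentDensity {t r : ℝ} (ht : 0 < t) (hr : -1 < r) (p ζ : ℝ) (N : ℤ) :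
    fourierInt (fun x => ((momentDensity t p r (x + ζ) : ℝ) : ℂ)) N =
      ((t ^ (-(r + 1) / 2) * Real.Gamma ((r + 1) / 2) : ℝ) : ℂ) *
        (cexp (2 * Real.pi * I * N * ζ) * kummer (((r : ℂ) + 1) / 2) (1 / 2)
          (((p - Real.pi * I * N) / (Real.sqrt t : ℂ)) ^ 2)) := by
  have hsq : ((Real.sqrt t : ℝ) : ℂ) ^ 2 = t := by
    rw [← ofReal_pow, Real.sq_sqrt ht.le]
  rw [div_pow, hsq, mul_left_comm, ← integral_abs_rpow_mul_exp ht hr, ← integral_const_mul]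
  unfold fourierInt
  rw [← integral_add_right_eq_self (fun x : ℝ => cexp (2 * Real.pi * I * N * ζ) *
    (((|x| ^ r : ℝ) : ℂ) * cexp (-t * x ^ 2 + 2 * x * (p - Real.pi * I * N)))) ζ]
  refine integral_congr_ae (Eventually.of_forall fun x => ?_)
  simp only [ofReal_momentDensity]
  rw [mul_left_comm, mul_left_comm (cexp (2 * Real.pi * I * N * ζ)), ← Complex.exp_add,
    ← Complex.exp_add]
  congr 2
  push_cast
  ring

lemma coherentState_mem_domain_hasSum {t r ζ : ℝ} (ht : 0 < t) (hr : -1 < r) (θ₀ p : ℝ)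
    (hζ : r < 0 → ∀ n : ℤ, ζ ≠ (n : ℝ)) :
    ∃ hΨ : coherentState ht θ₀ p ζ ∈ (absMomentumPow t ζ r).domain,
      HasSum (fun n : ℤ => ((|t * (n + ζ)| ^ r : ℝ) : ℂ) •
        coherentTerm t θ₀ p ζ n 0 • planeWaveVec ζ n)
        (absMomentumPow t ζ r ⟨coherentState ht θ₀ p ζ, hΨ⟩) := by
  have hs : Summable (fun n : ℤ => ((|t * (n + ζ)| ^ r : ℝ) : ℂ) •
      coherentTerm t θ₀ p ζ n 0 • planeWaveVec ζ n) := by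
    -- Up to `t^r`, the norms are moment densities with parameters `t/2` and `p/2`, so the Poisson
    -- lemma already gives summability.
    refine Summable.of_norm_bounded
      ((summable_momentDensity (half_pos ht) hr (p / 2) hζ).mul_left (t ^ r)) fun n => ?_
    rw [norm_smul, norm_smul, (orthonormal_planeWaveVec ζ).1 n, mul_one, norm_coherentTerm,
      norm_real, Real.norm_of_nonneg (by positivity), abs_mul, abs_of_pos ht,
      Real.mul_rpow ht.le (abs_nonneg _), momentDensity, mul_assoc]
    apply le_of_eq
    congr 3
    ring
  -- The spectral sum over all real `μ` is supported on the eigenvalues `t(n+ζ)` and is reindexed by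
  -- `n`.
  have hiff {a : CircleL2} := (momentum_eigenvalue_injective ht ζ).hasSum_iff (a := a)
    (f := fun μ : ℝ => ((|μ| ^ r : ℝ) : ℂ) •
      spectralProj (momentum t ζ) μ (coherentState ht θ₀ p ζ))
    (fun μ hμ => by rw [spectralProj_coherentState_eq_zero ht θ₀ p ζ hμ, smul_zero])
  have hcomp : (fun μ : ℝ => ((|μ| ^ r : ℝ) : ℂ) •
      spectralProj (momentum t ζ) μ (coherentState ht θ₀ p ζ)) ∘
        (fun n : ℤ => t * ((n : ℝ) + ζ)) = fun n : ℤ => ((|t * (n + ζ)| ^ r : ℝ) : ℂ) •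
        coherentTerm t θ₀ p ζ n 0 • planeWaveVec ζ n := by
    funext n
    simp only [Function.comp_apply, spectralProj_coherentState]
  rw [hcomp] at hiff
  have hsum := hiff.1 hs.hasSum
  refine ⟨hsum.summable, ?_⟩
  exact hiff.2 hsum.summable.hasSum

/-! ### The squared norm and its theta dual. -/

lemma hasSum_norm_sq_coherentState {t : ℝ} (ht : 0 < t) (θ₀ p ζ : ℝ) :
    HasSum (fun n : ℤ => Real.exp (-t * ((n : ℝ) + ζ) ^ 2 + 2 * ((n : ℝ) + ζ) * p))
      (‖coherentState ht θ₀ p ζ‖ ^ 2) := by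
  have h := hasSum_inner_coherentState ht θ₀ p ζ (a := fun _ => 1) (χ := coherentState ht θ₀ p ζ)
    (by simpa using hasSum_coherentState ht θ₀ p ζ)
  rw [inner_self_eq_norm_sq_to_K] at h
  have h2 : HasSum (fun n : ℤ => ((Real.exp (-t * ((n : ℝ) + ζ) ^ 2 + 2 * ((n : ℝ) + ζ) * p) : ℝ) : ℂ))
      ((‖coherentState ht θ₀ p ζ‖ ^ 2 : ℝ) : ℂ) := by
    simp only [one_mul] at h
    rw [ofReal_pow]
    exact h
  exact hasSum_ofReal.1 h2

lemma coherentState_ne_zero {t : ℝ} (ht : 0 < t) (θ₀ p ζ : ℝ) : coherentState ht θ₀ p ζ ≠ 0 := by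
  intro h0
  have h := hasSum_norm_sq_coherentState ht θ₀ p ζ
  have h1 := le_hasSum h 0 fun n _ => (Real.exp_pos _).le
  rw [h0, norm_zero, zero_pow two_ne_zero] at h1
  exact absurd h1 (not_le.2 (Real.exp_pos _))

lemma summable_theta_dual {t : ℝ} (ht : 0 < t) (p ζ : ℝ) :
    Summable (fun N : ℤ => cexp (2 * Real.pi * I * N * ζ) *
        cexp (-(I * p + N * Real.pi) ^ 2 / t)) := by
  have ht' : (t : ℂ) ≠ 0 := ofReal_ne_zero.2 ht.ne'
  have hτ : 0 < (((Real.pi / t : ℝ) : ℂ) * I).im := by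
    have := Real.pi_pos
    simp only [mul_im, ofReal_re, I_im, ofReal_im, I_re, mul_one, mul_zero, add_zero]
    positivity
  have h := (summable_jacobiTheta₂_term_iff (((ζ - p / t : ℝ) : ℂ)) _).2 hτ
  refine (h.mul_left (cexp (p ^ 2 / t))).congr fun N => ?_
  rw [jacobiTheta₂_term, ← Complex.exp_add, ← Complex.exp_add]
  congr 1
  push_cast
  field_simp
  ring_nf
  simp only [I_sq]
  ring

lemma tsum_gaussian_eq_theta_dual {t : ℝ} (ht : 0 < t) (p ζ : ℝ) :
    ∑' n : ℤ, cexp (-t * ((n : ℂ) + ζ) ^ 2 + 2 * ((n : ℂ) + ζ) * p) =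
      (Real.sqrt (Real.pi / t) : ℂ) * ∑' N : ℤ, cexp (2 * Real.pi * I * N * ζ) *
        cexp (-(I * p + N * Real.pi) ^ 2 / t) := by
  have ht' : (t : ℂ) ≠ 0 := ofReal_ne_zero.2 ht.ne'
  have hpi : (Real.pi : ℂ) ≠ 0 := ofReal_ne_zero.2 Real.pi_ne_zero
  have hpi0 := Real.pi_pos
  -- The parameters `t/π` and `(p - tζ)/π` arise from expanding the square and extracting the
  -- `n`-independent factor.
  have h := Complex.tsum_exp_neg_quadratic (a := ((t / Real.pi : ℝ) : ℂ))
    (by rw [ofReal_re]; positivity) (((p - t * ζ) / Real.pi : ℝ) : ℂ)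
  have hc : 1 / ((t / Real.pi : ℝ) : ℂ) ^ (1 / 2 : ℂ) = (Real.sqrt (Real.pi / t) : ℂ) := by
    have : (1 / 2 : ℂ) = ((1 / 2 : ℝ) : ℂ) := by push_cast; rfl
    rw [this, ← ofReal_cpow (by positivity), ← Real.sqrt_eq_rpow, ← ofReal_one, ← ofReal_div,
      ← Real.sqrt_one, ← Real.sqrt_div zero_le_one, one_div_div]
  rw [hc] at h
  have h1 : ∑' n : ℤ, cexp (-t * ((n : ℂ) + ζ) ^ 2 + 2 * ((n : ℂ) + ζ) * p) =
      cexp (-t * ζ ^ 2 + 2 * ζ * p) * ∑' n : ℤ, cexp (-Real.pi * ((t / Real.pi : ℝ) : ℂ) * n ^ 2 +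
        2 * Real.pi * (((p - t * ζ) / Real.pi : ℝ) : ℂ) * n) := by
    rw [← tsum_mul_left]
    refine tsum_congr fun n => ?_
    rw [← Complex.exp_add]
    congr 1
    push_cast
    field_simp
    ring
  rw [h1, h, mul_left_comm, ← tsum_mul_left]
  congr 1
  refine tsum_congr fun n => ?_
  rw [← Complex.exp_add, ← Complex.exp_add]
  congr 1
  push_cast
  field_simp
  ring_nf
  simp only [I_sq]
  ring

end CircleCoherent

open CircleCoherent in
theorem mainTheorem2 (t θ₀ p ζ r : ℝ) (ht : 0 < t) (hr : -1 < r)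
    (hζ : r < 0 → ∀ n : ℤ, ζ ≠ (n : ℝ)) :
    coherentState ht θ₀ p ζ ≠ 0 ∧
    HasSum (fun n : ℤ => Real.exp (-t * ((n : ℝ) + ζ) ^ 2) * Real.exp (2 * ((n : ℝ) + ζ) * p))
      (‖coherentState ht θ₀ p ζ‖ ^ 2) ∧
    (∃ S : ℂ,
      HasSum (fun N : ℤ => Complex.exp (2 * Real.pi * Complex.I * N * ζ) *
        Complex.exp (-(Complex.I * p + N * Real.pi) ^ 2 / t)) S ∧
      ((‖coherentState ht θ₀ p ζ‖ ^ 2 : ℝ) : ℂ) = (Real.sqrt (Real.pi / t) : ℂ) * S) ∧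
    ∃ hΨ : coherentState ht θ₀ p ζ ∈ (absMomentumPow t ζ r).domain,
      ∃ S : ℂ,
        HasBilateralSum (fun N : ℤ => Complex.exp (2 * Real.pi * Complex.I * N * ζ) *
          kummer (((r : ℂ) + 1) / 2) (1 / 2)
            (((p - Real.pi * Complex.I * N) / (Real.sqrt t : ℂ)) ^ 2)) S ∧
        expectation (absMomentumPow t ζ r) ⟨coherentState ht θ₀ p ζ, hΨ⟩ =
          (((‖coherentState ht θ₀ p ζ‖ ^ 2)⁻¹ * Real.sqrt t ^ (r - 1) *
            Real.Gamma ((r + 1) / 2) : ℝ) : ℂ) * S := by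
  have hnorm := hasSum_norm_sq_coherentState ht θ₀ p ζ
  refine ⟨coherentState_ne_zero ht θ₀ p ζ, ?_, ⟨_, (summable_theta_dual ht p ζ).hasSum, ?_⟩, ?_⟩
  · simpa only [Real.exp_add] using hnorm
  · rw [← tsum_gaussian_eq_theta_dual ht, ← (Complex.hasSum_ofReal.2 hnorm).tsum_eq]
    refine tsum_congr fun n => ?_
    push_cast
    rfl
  · obtain ⟨hΨ, hsum⟩ := coherentState_mem_domain_hasSum ht hr θ₀ p hζ
    obtain ⟨S, hS, hbil⟩ := poisson_momentDensity ht hr p hζ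
    set K : ℝ := t ^ (-(r + 1) / 2) * Real.Gamma ((r + 1) / 2) with hK
    have hΓ : 0 < Real.Gamma ((r + 1) / 2) := Real.Gamma_pos_of_pos (by linarith)
    have hK0 : (K : ℂ) ≠ 0 := Complex.ofReal_ne_zero.2 (mul_pos (Real.rpow_pos_of_pos ht _) hΓ).ne'
    -- `K` is the common prefactor of all Fourier coefficients, and `S` is the sum of the moment
    -- density over `n + ζ`.
    refine ⟨hΨ, (K : ℂ)⁻¹ * S, ?_, ?_⟩
    · convert hbil.mul_left (K : ℂ)⁻¹ using 2 with N
      rw [fourierInt_momentDensity ht hr, ← hK, inv_mul_cancel_left₀ hK0]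
    · have hinner := hasSum_inner_coherentState ht θ₀ p ζ hsum
      have hval : inner ℂ (coherentState ht θ₀ p ζ)
          (absMomentumPow t ζ r ⟨coherentState ht θ₀ p ζ, hΨ⟩) = ((t ^ r : ℝ) : ℂ) * S := by
        refine hinner.unique ?_
        refine (hS.mul_left ((t ^ r : ℝ) : ℂ)).congr_fun fun n => ?_
        rw [← Complex.ofReal_mul, abs_mul, abs_of_pos ht, Real.mul_rpow ht.le (abs_nonneg _),
          momentDensity, mul_assoc]
      -- The prefactors match because `(r-1)/2 = r - (r+1)/2`.
      have hpow : t ^ r = Real.sqrt t ^ (r - 1) * Real.Gamma ((r + 1) / 2) * K⁻¹ := by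
        have h1 : Real.sqrt t ^ (r - 1) = t ^ r * t ^ (-(r + 1) / 2) := by
          rw [Real.sqrt_eq_rpow, ← Real.rpow_mul ht.le, ← Real.rpow_add ht]
          congr 1
          ring
        have h2 : t ^ (-(r + 1) / 2) ≠ 0 := (Real.rpow_pos_of_pos ht _).ne'
        rw [h1, hK]
        field_simp
      unfold expectation
      rw [hval, hpow]
      push_cast
      ring
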